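/- Say that a set $\Lambda\subset\mathbb R$ has \emph{bounded density} if $\sup_{x\in\mathbb R}\#(\Lambda\cap[x,x+1))<+\infty$, and \emph{tempered growth} if all the sets $\Lambda\cap(-r,r)$, $r>0$, are finite and there is $N$ such that $\#(\Lambda\cap(-r,r))=O(r^N)$ as $r\to+\infty$. For $f\in L^1(\mathbb R)$ (complex-valued), a discrete set $\Lambda\subset\mathbb R$ and $w\in\mathbb C$, say that $f+\Lambda$ is a \emph{tiling at level $w$} if, for almost every $x\in\mathbb R$, the series $\sum_{\lambda\in\Lambda}f(x-\lambda)$ converges absolutely and its sum is $w$. \textbf{Theorem.} For every $\varepsilon>0$ there is a set $\Lambda\subset\bigcup_{n\in\mathbb Z}(n-\varepsilon,n+\varepsilon)$ which is not of bounded density but has tempered growth, with the following property: for every scalar $w\in\mathbb C$ there is a nonzero function $f$ in the Schwartz class such that $f+\Lambda$ is a tiling at level $w$. -/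

import Mathlib

open MeasureTheory Filter
open scoped SchwartzMap

/-- `Λ ⊆ ℝ` has bounded density: `sup_x #(Λ ∩ [x, x+1)) < ∞`, cardinalities and the supremum
being taken in `ℕ∞`. -/
def HasBoundedDensity (Λ : Set ℝ) : Prop :=
  (⨆ x : ℝ, (Λ ∩ Set.Ico x (x + 1)).encard) < ⊤

/-- `Λ ⊆ ℝ` has tempered growth: there is `N` with `#(Λ ∩ (-r, r)) = O(r ^ N)` as `r → +∞`.
Finiteness is stated explicitly because `Set.ncard` is `0` on infinite sets. -/
def HasTemperedGrowth (Λ : Set ℝ) : Prop :=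
  (∀ r : ℝ, (Λ ∩ Set.Ioo (-r) r).Finite) ∧
    ∃ N : ℕ, (fun r : ℝ => ((Λ ∩ Set.Ioo (-r) r).ncard : ℝ)) =O[atTop] fun r : ℝ => r ^ N

/-- `f + Λ` is a tiling of `ℝ` at level `w`: `f` is integrable, `Λ` is discrete, and for almost every
`x` the series `∑_{a ∈ Λ} f (x - a)` converges absolutely and its sum is `w`. -/
def IsTiling (f : ℝ → ℂ) (Λ : Set ℝ) (w : ℂ) : Prop :=
  Integrable f volume ∧ IsDiscrete Λ ∧
    ∀ᵐ x : ℝ, Summable (fun a : Λ => ‖f (x - a)‖) ∧ HasSum (fun a : Λ => f (x - a)) w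

/-! Near each integer `n` place `n ^ 2 + 1` distinct points `n + t (n, i)` with tiny shifts, so that
the density is unbounded but the growth is cubic. The shifts are chosen so that, for `f` with
spectrum in `[-1/4, 1/4]`, the points give the same sum of translates as the integers with
multiplicities.

Such functions obey a sampling formula `h (x - y) = ∑ m, kernel (y - m) * h (x - m)`
(`hasSum_kernel_mul_fourier`), where `kernel` decays fast and is `1` at `0` and `0` at the other
integers. Applied to `h = f'`, it writes the change in the sum as a combination of the values `f' (x
- k)`, with coefficients `∑ p, ∫ s in 0..t p, kernel (n - k + s)` up to sign
(`hasSum_fourier_perturbed`). It is enough that all of these vanish. They do not involve `f` or the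
level, so one set serves every `w`.

To first order the `k`-th coefficient is the sum of the shifts at `k`. Writing the shifts as a
common `u n` plus prescribed distinct offsets, the equations become a fixed point problem for a
bounded sequence `u`, contracting for small shifts (`exists_perturbation`).

Finally, integers with quadratic multiplicities are tiled by a second difference: summing by parts
turns `n ^ 2 + 1` into the constant `2`, and Poisson summation gives any level
(`exists_tiling_integers`). -/

/-- The number of points placed near the integer `n`. -/
def mult (n : ℤ) : ℕ := n.natAbs ^ 2 + 1

lemma cast_mult (n : ℤ) : (mult n : ℝ) = (n : ℝ) ^ 2 + 1 := by
  simp [mult, Nat.cast_natAbs]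

lemma mult_pos (n : ℤ) : (0 : ℝ) < mult n := by
  rw [cast_mult]; positivity

/-! ### Sums weighted by the multiplicities. -/

/-- Submultiplicativity of the weight: convolution-type sums over all points, centred at `k`, cost
only a factor `mult k`. -/
lemma mult_le_two_mul (n k : ℤ) : (mult n : ℝ) ≤ 2 * mult k * mult (n - k) := by
  simp only [cast_mult]
  push_cast
  nlinarith [sq_nonneg ((k : ℝ) * (n - k)), sq_nonneg ((n : ℝ) - 2 * k)]

/-- The index set of the points: pairs of an integer `n` and one of `mult n` labels. -/
abbrev PointIndex : Type := Σ n : ℤ, Fin (mult n)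

lemma hasSum_pointIndex_of_fst {b : ℤ → ℝ} (hb : ∀ n, 0 ≤ b n)
    (hs : Summable fun n => mult n * b n) :
    HasSum (fun a : PointIndex => b a.1) (∑' n, mult n * b n) := by
  have hsum : Summable fun a : PointIndex => b a.1 := by
    rw [summable_sigma_of_nonneg (fun a => hb a.1)]
    refine ⟨fun n => Summable.of_finite, ?_⟩
    simpa using hs
  have h := hsum.hasSum.sigma (g := fun n => mult n * b n) fun n => by
    simpa using hasSum_fintype (fun _ : Fin (mult n) => b n)
  rw [h.tsum_eq]
  exact hsum.hasSum

lemma norm_bound_nonneg {E : Type*} [NormedAddCommGroup E] {F : PointIndex → E} {b : ℤ → ℝ}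
    (h : ∀ a, ‖F a‖ ≤ b a.1) (n : ℤ) : 0 ≤ b n :=
  (norm_nonneg _).trans (h ⟨n, ⟨0, Nat.succ_pos _⟩⟩)

lemma summable_pointIndex {E : Type*} [NormedAddCommGroup E] [CompleteSpace E]
    {F : PointIndex → E} {b : ℤ → ℝ} (hs : Summable fun n => mult n * b n)
    (h : ∀ a, ‖F a‖ ≤ b a.1) : Summable F :=
  Summable.of_norm_bounded (hasSum_pointIndex_of_fst (norm_bound_nonneg h) hs).summable h

lemma summable_mult_mul_shift {B : ℤ → ℝ} (hB : ∀ j, 0 ≤ B j)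
    (hs : Summable fun j => mult j * B j) (k : ℤ) : Summable fun n => mult n * B (n - k) := by
  have h := ((Equiv.subRight k).summable_iff.2 hs).mul_left (2 * (mult k : ℝ))
  refine Summable.of_nonneg_of_le (fun n => mul_nonneg (mult_pos n).le (hB _)) (fun n => ?_) h
  have := mul_le_mul_of_nonneg_right (mult_le_two_mul n k) (hB (n - k))
  simpa [mul_assoc] using this

lemma tsum_mult_mul_shift_le {B : ℤ → ℝ} (hB : ∀ j, 0 ≤ B j)
    (hs : Summable fun j => mult j * B j) (k : ℤ) :
    ∑' n, mult n * B (n - k) ≤ 2 * mult k * ∑' j, mult j * B j := by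
  have h := ((Equiv.subRight k).summable_iff.2 hs).mul_left (2 * (mult k : ℝ))
  have h1 : ∑' n, mult n * B (n - k) ≤
      ∑' n, 2 * (mult k : ℝ) * (((fun j => mult j * B j) ∘ Equiv.subRight k) n) := by
    refine (summable_mult_mul_shift hB hs k).tsum_le_tsum (fun n => ?_) h
    have := mul_le_mul_of_nonneg_right (mult_le_two_mul n k) (hB (n - k))
    simpa [mul_assoc] using this
  rw [tsum_mul_left] at h1
  have h2 := (Equiv.subRight k).tsum_eq (fun j => mult j * B j)
  simp only [Function.comp_apply] at h1
  rwa [h2] at h1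

/-- The factor `mult k` is exactly what the fixed point equation divides by, so the resulting
estimates are uniform in `k`. -/
lemma norm_tsum_pointIndex_le {F : PointIndex → ℝ} {B : ℤ → ℝ} {D : ℝ} (hD : 0 ≤ D)
    (hB : ∀ j, 0 ≤ B j) (hs : Summable fun j => mult j * B j) (k : ℤ)
    (h : ∀ a, ‖F a‖ ≤ B (a.1 - k) * D) :
    Summable F ∧ ‖∑' a, F a‖ ≤ mult k * (2 * (∑' j, mult j * B j) * D) := by
  have hs' : Summable fun n => mult n * (B (n - k) * D) := by
    simpa [mul_assoc] using (summable_mult_mul_shift hB hs k).mul_right D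
  refine ⟨summable_pointIndex (b := fun n => B (n - k) * D) hs' h, ?_⟩
  refine (tsum_of_norm_bounded (hasSum_pointIndex_of_fst
    (b := fun n => B (n - k) * D) (norm_bound_nonneg (b := fun n => B (n - k) * D) h) hs') h).trans ?_
  have : ∑' n, mult n * (B (n - k) * D) = (∑' n, mult n * B (n - k)) * D := by
    rw [← tsum_mul_right]; simp [mul_assoc]
  rw [this]
  calc _ ≤ (2 * mult k * ∑' j, mult j * B j) * D :=
        mul_le_mul_of_nonneg_right (tsum_mult_mul_shift_le hB hs k) hD
    _ = _ := by ring

/-! ### Choosing the shifts by a fixed point argument. -/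

/-- Truncation of a real number to `[-r, r]`. -/
def clamp (r x : ℝ) : ℝ := max (-r) (min x r)

lemma abs_clamp_le {r : ℝ} (hr : 0 ≤ r) (x : ℝ) : |clamp r x| ≤ r := by
  rw [abs_le, clamp]
  exact ⟨le_max_left _ _, max_le (by linarith) (min_le_right _ _)⟩

lemma clamp_of_abs_le {r x : ℝ} (h : |x| ≤ r) : clamp r x = x := by
  rw [abs_le] at h
  rw [clamp, min_eq_left h.2, max_eq_right h.1]

lemma abs_clamp_sub_le (r x y : ℝ) : |clamp r x - clamp r y| ≤ |x - y| := by
  unfold clamp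
  refine (abs_max_sub_max_le_max _ _ _ _).trans ?_
  refine max_le (by simp) ((abs_min_sub_min_le_max _ _ _ _).trans (by simp))

/-- The second-order part of `∫ s in 0..t, K (j + s)`. -/
noncomputable def remainder (K : ℝ → ℝ) (j : ℤ) (t : ℝ) : ℝ := ∫ s in (0 : ℝ)..t, (K (j + s) - K j)

/-- The integrand is at most `B j * r` on `[-r, r]`; the extra factor `r` is what makes the map
below contract. -/
lemma abs_remainder_sub_le {K : ℝ → ℝ} (hK : Continuous K) {B : ℤ → ℝ}
    (hB : ∀ (j : ℤ) (s : ℝ), |s| ≤ 1 → |K (j + s) - K j| ≤ B j * |s|) (hB0 : ∀ j, 0 ≤ B j)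
    {r : ℝ} (hr1 : r ≤ 1) (j : ℤ) {t t' : ℝ} (ht : |t| ≤ r) (ht' : |t'| ≤ r) :
    |remainder K j t - remainder K j t'| ≤ B j * (r * |t - t'|) := by
  have hc : Continuous fun s : ℝ => K (j + s) - K j := by fun_prop
  unfold remainder
  rw [intervalIntegral.integral_interval_sub_left (hc.intervalIntegrable _ _)
    (hc.intervalIntegrable _ _), ← mul_assoc]
  rw [← Real.norm_eq_abs (∫ _ in t'..t, _)]
  refine intervalIntegral.norm_integral_le_of_norm_le_const fun s hs => ?_
  have hsr : |s| ≤ r := by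
    rw [abs_le] at *
    have := Set.uIoc_subset_uIcc hs
    rw [Set.mem_uIcc] at this
    constructor <;> rcases this with h | h <;> linarith
  rw [Real.norm_eq_abs]
  exact (hB j s (hsr.trans hr1)).trans (mul_le_mul_of_nonneg_left hsr (hB0 j))

lemma integral_eq_mul_add_remainder {K : ℝ → ℝ} (hK : Continuous K) (j : ℤ) (t : ℝ) :
    ∫ s in (0 : ℝ)..t, K (j + s) = t * K j + remainder K j t := by
  have hc : Continuous fun s : ℝ => K (j + s) := by fun_prop
  unfold remainder
  rw [intervalIntegral.integral_sub (hc.intervalIntegrable _ _) (by simp)]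
  simp

-- With `t (n, i) = u n + τ (n, i)`, the `k`-th equation reads `mult k * u k + T k + S u k = 0`: `T
-- k` sums the offsets at `k`, `S` collects the remainders. Solving for `u k` gives a contraction of
-- the bounded sequences.
open scoped BoundedContinuousFunction in
theorem exists_perturbation {K : ℝ → ℝ} (hK : Continuous K)
    (hK0 : ∀ j : ℤ, K j = if j = 0 then 1 else 0) {B : ℤ → ℝ} (hB0 : ∀ j, 0 ≤ B j)
    (hB : ∀ (j : ℤ) (s : ℝ), |s| ≤ 1 → |K (j + s) - K j| ≤ B j * |s|)
    (hs : Summable fun j => mult j * B j) {ε : ℝ} (hε : 0 < ε) :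
    ∃ t : PointIndex → ℝ, (∀ n, Function.Injective fun i => t ⟨n, i⟩) ∧ (∀ a, |t a| < ε) ∧
      ∀ k : ℤ, HasSum (fun a : PointIndex => ∫ s in (0 : ℝ)..t a, K ((a.1 - k : ℤ) + s)) 0 := by
  set C : ℝ := 2 * ∑' j, mult j * B j with hC
  have hC0 : 0 ≤ C := mul_nonneg zero_le_two
    (tsum_nonneg fun j => mul_nonneg (mult_pos j).le (hB0 j))
  -- Shifts have size at most `3δ`: `2δ` from `u` and `δ` from `τ`. The condition `9Cδ ≤ 1` yields
  -- both `|S u k| ≤ mult k * δ` and the Lipschitz constant `3Cδ ≤ 1/3`.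
  obtain ⟨δ, hδ0, hδε, hδ1, hδC⟩ : ∃ δ : ℝ, 0 < δ ∧ 3 * δ < ε ∧ 3 * δ ≤ 1 ∧ 9 * C * δ ≤ 1 := by
    refine ⟨min (ε / 4) (1 / (9 * (C + 1))), by positivity, ?_, ?_, ?_⟩
    · linarith [min_le_left (ε / 4) (1 / (9 * (C + 1)))]
    · have h1 : 1 / (9 * (C + 1)) ≤ 1 / 9 := by gcongr; linarith
      linarith [min_le_right (ε / 4) (1 / (9 * (C + 1)))]
    · calc 9 * C * min (ε / 4) (1 / (9 * (C + 1))) ≤ 9 * C * (1 / (9 * (C + 1))) := by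
            gcongr; exact min_le_right _ _
        _ ≤ 1 := by rw [mul_one_div, div_le_one (by positivity)]; linarith
  let τ : PointIndex → ℝ := fun a => δ * (a.2 / mult a.1)
  have hτ : ∀ a, |τ a| ≤ δ := fun a => by
    have h1 : ((a.2 : ℕ) : ℝ) / mult a.1 ≤ 1 := by
      rw [div_le_one (mult_pos _)]; exact_mod_cast a.2.2.le
    have h0 : 0 ≤ ((a.2 : ℕ) : ℝ) / mult a.1 := by positivity
    rw [abs_of_nonneg (mul_nonneg hδ0.le h0)]
    nlinarith
  have hcτ : ∀ (u : ℤ → ℝ) a, |clamp (2 * δ) (u a.1) + τ a| ≤ 3 * δ := fun u a => by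
    have := abs_add_le (clamp (2 * δ) (u a.1)) (τ a)
    linarith [hτ a, abs_clamp_le (by linarith : 0 ≤ 2 * δ) (u a.1)]
  -- Truncating `u` makes the map defined and contracting on the whole space, with no invariant ball
  -- needed; the fixed point is bounded by `2δ`, so truncation leaves it unchanged.
  let S : (ℤ → ℝ) → ℤ → ℝ := fun u k =>
    ∑' a : PointIndex, remainder K (a.1 - k) (clamp (2 * δ) (u a.1) + τ a)
  have hSb : ∀ u k, Summable (fun a : PointIndex =>
      remainder K (a.1 - k) (clamp (2 * δ) (u a.1) + τ a)) ∧ |S u k| ≤ mult k * δ := fun u k => by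
    have h := norm_tsum_pointIndex_le (D := 3 * δ * (3 * δ)) (by positivity) hB0 hs k
      (F := fun a => remainder K (a.1 - k) (clamp (2 * δ) (u a.1) + τ a)) fun a => by
        have h := abs_remainder_sub_le hK hB hB0 hδ1 (a.1 - k) (hcτ u a)
          (t' := 0) (by simpa using hδ0.le)
        simp only [remainder, intervalIntegral.integral_same, sub_zero] at h ⊢
        refine h.trans (mul_le_mul_of_nonneg_left ?_ (hB0 _))
        exact mul_le_mul_of_nonneg_left (hcτ u a) (by linarith)
    refine ⟨h.1, h.2.trans (mul_le_mul_of_nonneg_left ?_ (mult_pos k).le)⟩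
    rw [← hC]
    nlinarith
  have hSl : ∀ (u v : ℤ → ℝ) (D : ℝ), 0 ≤ D → (∀ n, |u n - v n| ≤ D) → ∀ k,
      |S u k - S v k| ≤ mult k * (1 / 3 * D) := fun u v D hD huv k => by
    have h := norm_tsum_pointIndex_le (D := 3 * δ * D) (by positivity) hB0 hs k
      (F := fun a => remainder K (a.1 - k) (clamp (2 * δ) (u a.1) + τ a)
        - remainder K (a.1 - k) (clamp (2 * δ) (v a.1) + τ a)) fun a => by
        refine (abs_remainder_sub_le hK hB hB0 hδ1 (a.1 - k) (hcτ u a) (hcτ v a)).trans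
          (mul_le_mul_of_nonneg_left ?_ (hB0 _))
        refine mul_le_mul_of_nonneg_left ?_ (by linarith)
        rw [add_sub_add_right_eq_sub]
        exact (abs_clamp_sub_le _ _ _).trans (huv _)
    have h2 := h.2
    rw [(hSb u k).1.tsum_sub (hSb v k).1] at h2
    refine h2.trans (mul_le_mul_of_nonneg_left ?_ (mult_pos k).le)
    rw [← hC]
    nlinarith
  let T : ℤ → ℝ := fun k => ∑ i : Fin (mult k), τ ⟨k, i⟩
  have hT : ∀ k, |T k| ≤ mult k * δ := fun k => by
    refine (Finset.abs_sum_le_sum_abs _ _).trans ?_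
    refine (Finset.sum_le_sum fun i _ => hτ ⟨k, i⟩).trans ?_
    simp
  have hφ : ∀ u k, |-((T k + S u k) / mult k)| ≤ 2 * δ := fun u k => by
    rw [abs_neg, abs_div, abs_of_pos (mult_pos k), div_le_iff₀ (mult_pos k)]
    linarith [abs_add_le (T k) (S u k), hT k, (hSb u k).2]
  let Φ : (ℤ →ᵇ ℝ) → (ℤ →ᵇ ℝ) := fun u =>
    BoundedContinuousFunction.ofNormedAddCommGroupDiscrete
      (fun k => -((T k + S u k) / mult k)) (2 * δ) (hφ u)
  have hΦ : ContractingWith (1 / 3) Φ := by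
    refine ⟨by norm_num [← NNReal.coe_lt_coe], LipschitzWith.of_dist_le_mul fun u v => ?_⟩
    rw [BoundedContinuousFunction.dist_le (by positivity)]
    intro k
    have h := hSl u v (dist u v) dist_nonneg
      (fun n => by simpa only [Real.dist_eq] using
        BoundedContinuousFunction.dist_coe_le_dist (f := u) (g := v) n) k
    change |-((T k + S u k) / mult k) - -((T k + S v k) / mult k)| ≤ _
    have e : -((T k + S u k) / mult k) - -((T k + S v k) / mult k)
        = -((S u k - S v k) / mult k) := by ring
    rw [e, abs_neg, abs_div, abs_of_pos (mult_pos k), div_le_iff₀ (mult_pos k)]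
    simp only [NNReal.coe_div, NNReal.coe_one, NNReal.coe_ofNat]
    linarith
  obtain ⟨u, hu⟩ : ∃ u, Φ u = u := ⟨_, hΦ.fixedPoint_isFixedPt⟩
  have hu' : ∀ k, u k = -((T k + S u k) / mult k) := fun k => by
    conv_lhs => rw [← hu]
    rfl
  have huδ : ∀ k, |u k| ≤ 2 * δ := fun k => by rw [hu']; exact hφ u k
  have hcl : ∀ k, clamp (2 * δ) (u k) = u k := fun k => clamp_of_abs_le (huδ k)
  refine ⟨fun a => u a.1 + τ a, fun n i j hij => ?_, fun a => ?_, fun k => ?_⟩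
  · have h : δ * (((i : ℕ) : ℝ) / mult n) = δ * (((j : ℕ) : ℝ) / mult n) := add_left_cancel hij
    have h2 := mul_left_cancel₀ hδ0.ne' h
    rw [div_left_inj' (mult_pos n).ne'] at h2
    exact Fin.ext (by exact_mod_cast h2)
  · have := hcτ u a
    rw [hcl] at this
    linarith
  · have h1 : HasSum (fun a : PointIndex => remainder K (a.1 - k) (u a.1 + τ a)) (S u k) := by
      have := (hSb u k).1.hasSum
      simp only [S]
      simpa only [hcl] using this
    -- Since `K` is a delta on the integers, only the points attached to `k` contribute to the
    -- linear part.
    have h2 : HasSum (fun a : PointIndex => (u a.1 + τ a) * K ((a.1 - k : ℤ) : ℝ))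
        (mult k * u k + T k) := by
      have h3 : HasSum (fun i : Fin (mult k) => (u k + τ ⟨k, i⟩)) (mult k * u k + T k) := by
        simpa [Finset.sum_add_distrib, T] using hasSum_fintype (fun i => (u k + τ ⟨k, i⟩))
      rw [← (sigma_mk_injective (β := fun n => Fin (mult n)) (i := k)).hasSum_iff]
      · convert h3 using 2 with i
        simp only [Function.comp_apply, hK0, sub_self, if_true, mul_one]
      · rintro ⟨n, i⟩ hn
        have : n ≠ k := by rintro rfl; exact hn ⟨i, rfl⟩
        simp only [hK0, sub_eq_zero, this, if_false, mul_zero]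
    have h4 := h2.add h1
    have h5 : mult k * u k + T k + S u k = 0 := by
      rw [hu' k]; field_simp [(mult_pos k).ne']; ring
    rw [h5] at h4
    simpa only [integral_eq_mul_add_remainder hK] using h4

/-! ### Decay of Schwartz functions against the multiplicities. -/

open scoped FourierTransform ContDiff

lemma summable_inv_mult : Summable fun n : ℤ => ((mult n : ℝ))⁻¹ := by
  have h := (Real.summable_one_div_int_pow (p := 2)).2 one_lt_two
  refine Summable.of_nonneg_of_le (fun n => by positivity) (fun n => ?_)
    (h.add (hasSum_ite_eq (0 : ℤ) (1 : ℝ)).summable)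
  rw [cast_mult]
  by_cases hn : n = 0
  · simp [hn]
  · have : (0 : ℝ) < (n : ℝ) ^ 2 := by positivity
    simp only [hn, if_false, add_zero, one_div]
    gcongr
    linarith

lemma one_add_sq_le (a b : ℝ) : 1 + a ^ 2 ≤ 2 * (1 + (a - b) ^ 2) * (1 + b ^ 2) := by
  nlinarith [sq_nonneg ((a - b) * b), sq_nonneg (a - 2 * b)]

lemma SchwartzMap.exists_norm_le_inv_sq (φ : 𝓢(ℝ, ℂ)) :
    ∃ C : ℝ, 0 ≤ C ∧ ∀ x, ‖φ x‖ ≤ C / (1 + x ^ 2) ^ 2 := by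
  refine ⟨2 ^ 4 * (Finset.Iic (4, 0)).sup (fun m => SchwartzMap.seminorm ℝ m.1 m.2) φ,
    by positivity, fun x => ?_⟩
  have h := SchwartzMap.one_add_le_sup_seminorm_apply (𝕜 := ℝ) (m := (4, 0)) le_rfl le_rfl φ x
  rw [norm_iteratedFDeriv_zero, Real.norm_eq_abs] at h
  rw [le_div_iff₀ (by positivity)]
  refine le_trans ?_ h
  rw [mul_comm]
  gcongr
  rw [show 4 = 2 * 2 from rfl, pow_mul]
  gcongr
  nlinarith [sq_abs x, abs_nonneg x]

/-- Two powers of `mult n` are gained: one absorbs the multiplicity, the other ensures summability.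
-/
lemma SchwartzMap.exists_norm_shift_le (φ : 𝓢(ℝ, ℂ)) (x : ℝ) :
    ∃ C : ℝ, 0 ≤ C ∧ ∀ (n : ℤ) (s : ℝ), |s| ≤ 1 → ‖φ (x - (n + s))‖ ≤ C * ((mult n : ℝ) ^ 2)⁻¹ := by
  obtain ⟨C, hC, h⟩ := φ.exists_norm_le_inv_sq
  set D : ℝ := 2 * (1 + (|x| + 1) ^ 2)
  have hD : 0 < D := by positivity
  refine ⟨C * D ^ 2, by positivity, fun n s hs => (h _).trans ?_⟩
  have h1 : (mult n : ℝ) ≤ D * (1 + (x - (n + s)) ^ 2) := by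
    rw [cast_mult]
    have h2 := one_add_sq_le n (x - s)
    have h3 : (x - s) ^ 2 ≤ (|x| + 1) ^ 2 := by
      rw [← sq_abs (x - s)]
      gcongr
      linarith [abs_sub x s]
    have h4 : ((n : ℝ) - (x - s)) ^ 2 = (x - (n + s)) ^ 2 := by ring
    rw [h4] at h2
    have h5 : 0 ≤ 1 + (x - (n + s)) ^ 2 := by positivity
    have := mul_le_mul_of_nonneg_left h3 h5
    simp only [D]
    linarith
  have hm := mult_pos n
  rw [div_le_iff₀ (by positivity), mul_assoc, mul_assoc]
  refine le_mul_of_one_le_right hC ?_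
  rw [mul_left_comm, ← mul_pow, ← div_eq_inv_mul, one_le_div (by positivity)]
  gcongr

/-! ### The bump and the interpolation kernel. -/

/-- A smooth even function, `1` on `[-1/4, 1/4]` and `0` outside `[-3/4, 3/4]`, whose integer
translates sum to `1`. -/
noncomputable def bump (ξ : ℝ) : ℝ :=
  Real.smoothTransition (2 * ξ + 3 / 2) - Real.smoothTransition (2 * ξ - 1 / 2)

lemma bump_eq_one {ξ : ℝ} (h : |ξ| ≤ 1 / 4) : bump ξ = 1 := by
  rw [abs_le] at h
  rw [bump, Real.smoothTransition.one_of_one_le (by linarith),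
    Real.smoothTransition.zero_of_nonpos (by linarith), sub_zero]

lemma bump_eq_zero {ξ : ℝ} (h : 3 / 4 ≤ |ξ|) : bump ξ = 0 := by
  rcases le_abs.1 h with h | h
  · rw [bump, Real.smoothTransition.one_of_one_le (by linarith),
      Real.smoothTransition.one_of_one_le (by linarith), sub_self]
  · rw [bump, Real.smoothTransition.zero_of_nonpos (by linarith),
      Real.smoothTransition.zero_of_nonpos (by linarith), sub_self]

lemma smoothTransition_one_sub (x : ℝ) :
    Real.smoothTransition (1 - x) = 1 - Real.smoothTransition x := by
  have := Real.smoothTransition.pos_denom x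
  simp only [Real.smoothTransition, sub_sub_cancel]
  rw [add_comm (expNegInvGlue (1 - x))]
  field_simp
  ring

lemma bump_neg (ξ : ℝ) : bump (-ξ) = bump ξ := by
  have h1 := smoothTransition_one_sub (2 * ξ - 1 / 2)
  have h2 := smoothTransition_one_sub (2 * ξ + 3 / 2)
  rw [bump, bump, show 2 * -ξ + 3 / 2 = 1 - (2 * ξ - 1 / 2) by ring,
    show 2 * -ξ - 1 / 2 = 1 - (2 * ξ + 3 / 2) by ring, h1, h2]
  ring

lemma contDiff_bump : ContDiff ℝ ∞ bump := by
  unfold bump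
  have h : ContDiff ℝ ∞ Real.smoothTransition := Real.smoothTransition.contDiff (n := ⊤)
  exact (h.comp (by fun_prop)).sub (h.comp (by fun_prop))

lemma tsum_bump_add_int (ξ : ℝ) : ∑' j : ℤ, bump (ξ + j) = 1 := by
  set m : ℤ := ⌊ξ + 1 / 4⌋ with hm
  have h1 := Int.floor_le (ξ + 1 / 4)
  have h2 := Int.lt_floor_add_one (ξ + 1 / 4)
  rw [← hm] at h1 h2
  -- As `ξ - m` lies in `[-1/4, 3/4)`, only these two translates can be nonzero; their inner
  -- transitions cancel.
  rw [tsum_eq_sum (s := {-m, -m - 1}) fun j hj => ?_, Finset.sum_pair (by omega)]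
  · have e : 2 * (ξ + ((-m - 1 : ℤ) : ℝ)) + 3 / 2 = 2 * (ξ + ((-m : ℤ) : ℝ)) - 1 / 2 := by
      push_cast; ring
    rw [bump, bump, e, Real.smoothTransition.one_of_one_le (by push_cast; linarith),
      Real.smoothTransition.zero_of_nonpos (x := 2 * (ξ + ((-m - 1 : ℤ) : ℝ)) - 1 / 2)
        (by push_cast; linarith)]
    ring
  · simp only [Finset.mem_insert, Finset.mem_singleton, not_or] at hj
    apply bump_eq_zero
    rcases (by omega : -m + 1 ≤ j ∨ j ≤ -m - 2) with h | h
    · have : (-m + 1 : ℝ) ≤ j := by exact_mod_cast h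
      exact le_abs.2 (Or.inl (by linarith))
    · have : (j : ℝ) ≤ -m - 2 := by exact_mod_cast h
      exact le_abs.2 (Or.inr (by linarith))

lemma hasCompactSupport_of_forall_abs {a : ℝ → ℂ} {R : ℝ} (h : ∀ ξ, R ≤ |ξ| → a ξ = 0) :
    HasCompactSupport a := by
  refine HasCompactSupport.intro (isCompact_Icc (a := -R) (b := R)) fun ξ hξ => h ξ ?_
  by_contra hc
  exact hξ (abs_le.1 (not_le.1 hc).le)

/-- The function `e^{2πiyξ} a(ξ)`. -/
noncomputable def modulate (y : ℝ) (a : ℝ → ℂ) (ξ : ℝ) : ℂ :=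
  Complex.exp (2 * Real.pi * y * ξ * Complex.I) * a ξ

lemma fourier_modulate (y : ℝ) (a : ℝ → ℂ) (x : ℝ) : 𝓕 (modulate y a) x = 𝓕 a (x - y) := by
  rw [Real.fourier_real_eq_integral_exp_smul, Real.fourier_real_eq_integral_exp_smul]
  congr 1 with ξ
  rw [modulate, smul_eq_mul, smul_eq_mul, ← mul_assoc, ← Complex.exp_add]
  congr 2
  push_cast
  ring

lemma contDiff_modulate (y : ℝ) {a : ℝ → ℂ} (ha : ContDiff ℝ ∞ a) :
    ContDiff ℝ ∞ (modulate y a) := by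
  unfold modulate
  refine ContDiff.mul (Complex.contDiff_exp.comp ?_) ha
  have : ContDiff ℝ ∞ (fun ξ : ℝ => (ξ : ℂ)) := Complex.ofRealCLM.contDiff
  fun_prop

/-- The bump as a complex-valued function. -/
noncomputable def cbump (ξ : ℝ) : ℂ := bump ξ

lemma contDiff_cbump : ContDiff ℝ ∞ cbump := Complex.ofRealCLM.contDiff.comp contDiff_bump

lemma cbump_eq_zero {ξ : ℝ} (h : 3 / 4 ≤ |ξ|) : cbump ξ = 0 := by
  simp [cbump, bump_eq_zero h]

/-- The Schwartz function `e^{2πiyξ} bump(ξ)`. -/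
noncomputable def modulatedBump (y : ℝ) : 𝓢(ℝ, ℂ) :=
  (hasCompactSupport_of_forall_abs (a := modulate y cbump) (R := 3 / 4)
    fun ξ h => by simp [modulate, cbump_eq_zero h]).toSchwartzMap
      (contDiff_modulate y contDiff_cbump)

lemma coe_modulatedBump (y : ℝ) : ⇑(modulatedBump y) = modulate y cbump := rfl

lemma modulate_zero (a : ℝ → ℂ) : modulate 0 a = a := by
  ext; simp [modulate]

/-- The interpolation kernel: the Fourier transform of the bump. -/
noncomputable def kernel (v : ℝ) : ℝ := (𝓕 (modulatedBump 0) v).re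

lemma fourier_modulatedBump_zero (v : ℝ) : 𝓕 (modulatedBump 0) v = 𝓕 cbump v := by
  rw [SchwartzMap.fourier_coe, coe_modulatedBump, modulate_zero]

lemma fourier_cbump_neg (v : ℝ) : 𝓕 cbump (-v) = 𝓕 cbump v := by
  rw [← Real.fourierInv_eq_fourier_neg, Real.fourierInv_eq_fourier_comp_neg]
  have : (fun ξ => cbump (-ξ)) = cbump := by
    ext ξ
    simp [cbump, bump_neg]
  rw [this]

lemma conj_fourier_cbump (v : ℝ) : (starRingEnd ℂ) (𝓕 cbump v) = 𝓕 cbump (-v) := by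
  rw [Real.fourier_real_eq_integral_exp_smul, Real.fourier_real_eq_integral_exp_smul,
    ← integral_conj]
  congr 1 with ξ
  rw [smul_eq_mul, smul_eq_mul, map_mul, cbump, Complex.conj_ofReal, ← Complex.exp_conj, map_mul,
    Complex.conj_ofReal, Complex.conj_I]
  congr 2
  push_cast
  ring

lemma ofReal_kernel (v : ℝ) : (kernel v : ℂ) = 𝓕 cbump v := by
  rw [kernel, fourier_modulatedBump_zero]
  exact Complex.conj_eq_iff_re.1 ((conj_fourier_cbump v).trans (fourier_cbump_neg v))

lemma kernel_neg (v : ℝ) : kernel (-v) = kernel v := by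
  have : (kernel (-v) : ℂ) = kernel v := by rw [ofReal_kernel, ofReal_kernel, fourier_cbump_neg]
  exact_mod_cast this

lemma continuous_kernel : Continuous kernel :=
  Complex.continuous_re.comp (𝓕 (modulatedBump 0)).continuous

/-- The values at integers are the Fourier coefficients of the periodized bump, which is the
constant `1`. -/
lemma kernel_int (j : ℤ) : kernel j = if j = 0 then 1 else 0 := by
  have hdec := (modulatedBump 0).isBigO_cocompact_rpow (-2)
  have hnorm : ∀ K : TopologicalSpace.Compacts ℝ, Summable fun n : ℤ =>
      ‖((⟨_, (modulatedBump 0).continuous⟩ : C(ℝ, ℂ)).comp (ContinuousMap.addRight (n : ℝ))).restrict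
        K‖ := fun K =>
    summable_of_isBigO (Real.summable_abs_int_rpow one_lt_two)
      ((isBigO_norm_restrict_cocompact ⟨_, (modulatedBump 0).continuous⟩ two_pos hdec K).comp_tendsto
        Int.tendsto_coe_cofinite)
  have h := Real.fourierCoeff_tsum_comp_add hnorm j
  have h1 : ∀ z, Function.Periodic.lift
      (ContinuousMap.periodic_tsum_comp_add_zsmul
        (⟨_, (modulatedBump 0).continuous⟩ : C(ℝ, ℂ)) 1) z = fourier 0 z := by
    intro z
    induction z using QuotientAddGroup.induction_on with
    | H ξ =>
      have hs := ContinuousMap.summable_of_locally_summable_norm hnorm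
      change (∑' n : ℤ, (⟨_, (modulatedBump 0).continuous⟩ : C(ℝ, ℂ)).comp
        (ContinuousMap.addRight (n • (1 : ℝ)))) ξ = fourier 0 (ξ : UnitAddCircle)
      simp only [zsmul_eq_mul, mul_one]
      rw [← ContinuousMap.tsum_apply hs, fourier_zero]
      simp only [ContinuousMap.comp_apply, ContinuousMap.coe_mk, ContinuousMap.coe_addRight,
        coe_modulatedBump, modulate_zero, cbump]
      rw [← Complex.ofReal_tsum, tsum_bump_add_int, Complex.ofReal_one]
  rw [funext h1, fourierCoeff_fourier] at h
  have h2 : (kernel j : ℂ) = if j = 0 then 1 else 0 := by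
    rw [ofReal_kernel]
    rw [← fourier_modulatedBump_zero, SchwartzMap.fourier_coe]
    refine h.symm.trans ?_
    simp [Pi.single_apply]
  split_ifs at h2 ⊢ <;> exact_mod_cast h2

/-- Mean value inequality with the Schwartz decay of the derivative; this supplies the hypotheses of
`exists_perturbation`. -/
lemma exists_kernel_bound : ∃ B : ℤ → ℝ, (∀ j, 0 ≤ B j) ∧
    (∀ (j : ℤ) (s : ℝ), |s| ≤ 1 → |kernel (j + s) - kernel j| ≤ B j * |s|) ∧
    Summable fun j => mult j * B j := by
  set Q := 𝓕 (modulatedBump 0)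
  obtain ⟨C, hC, h⟩ := (SchwartzMap.derivCLM ℝ ℂ Q).exists_norm_shift_le 0
  refine ⟨fun j => C * ((mult j : ℝ) ^ 2)⁻¹, fun j => by positivity, fun j s hs => ?_, ?_⟩
  · have h1 : ∀ v ∈ Set.Icc (j - 1 : ℝ) (j + 1), ‖deriv Q v‖ ≤ C * ((mult j : ℝ) ^ 2)⁻¹ := by
      intro v hv
      have h2 := h (-j) (j - v) (abs_le.2 ⟨by linarith [hv.2], by linarith [hv.1]⟩)
      have e : (0 : ℝ) - (((-j : ℤ) : ℝ) + (j - v)) = v := by push_cast; ring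
      rwa [e, SchwartzMap.derivCLM_apply, show mult (-j) = mult j by simp [mult]] at h2
    rw [abs_le] at hs
    have h3 := (convex_Icc (j - 1 : ℝ) (j + 1)).norm_image_sub_le_of_norm_deriv_le
      (fun v _ => Q.differentiableAt) h1 (x := (j : ℝ)) (y := (j : ℝ) + s)
      ⟨by linarith, by linarith⟩ ⟨by linarith, by linarith⟩
    rw [add_sub_cancel_left, Real.norm_eq_abs] at h3
    refine le_trans ?_ h3
    rw [kernel, kernel, ← Complex.sub_re]
    exact Complex.abs_re_le_norm _
  · refine (summable_inv_mult.mul_left C).congr fun n => ?_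
    have := (mult_pos n).ne'
    field_simp

/-! ### The sampling formula. -/

lemma SchwartzMap.summable_norm_shift (φ : 𝓢(ℝ, ℂ)) (x : ℝ) :
    Summable fun n : ℤ => mult n * ‖φ (x - n)‖ := by
  obtain ⟨C, hC, h⟩ := φ.exists_norm_shift_le x
  refine Summable.of_nonneg_of_le (fun n => by positivity) (fun n => ?_)
    (summable_inv_mult.mul_left C)
  have h1 := h n 0 (by simp)
  rw [add_zero] at h1
  refine (mul_le_mul_of_nonneg_left h1 (mult_pos n).le).trans (le_of_eq ?_)
  have := (mult_pos n).ne'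
  field_simp

lemma one_le_mult (n : ℤ) : (1 : ℝ) ≤ mult n := by
  exact_mod_cast Nat.succ_le_succ (Nat.zero_le _)

lemma summable_kernel_shift (y : ℝ) : Summable fun m : ℤ => |kernel (y - m)| := by
  refine Summable.of_nonneg_of_le (fun n => by positivity) (fun n => ?_)
    ((𝓕 (modulatedBump 0)).summable_norm_shift y)
  refine (Complex.abs_re_le_norm _).trans ?_
  exact le_mul_of_one_le_left (norm_nonneg _) (one_le_mult n)

/-- Poisson summation for the modulated bump: when `|ξ| ≤ 1/4`, the translates by nonzero integers
vanish at `ξ` and the bump itself is `1`. -/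
lemma hasSum_kernel_exp {ξ : ℝ} (hξ : |ξ| ≤ 1 / 4) (y : ℝ) :
    HasSum (fun m : ℤ => (kernel (y - m) : ℂ) * Complex.exp (2 * Real.pi * m * ξ * Complex.I))
      (Complex.exp (2 * Real.pi * y * ξ * Complex.I)) := by
  have hs : Summable (fun m : ℤ =>
      (kernel (y - m) : ℂ) * Complex.exp (2 * Real.pi * m * ξ * Complex.I)) := by
    refine Summable.of_norm_bounded (summable_kernel_shift y) fun m => le_of_eq ?_
    rw [norm_mul, Complex.norm_real, Real.norm_eq_abs]
    have : (2 * Real.pi * m * ξ * Complex.I : ℂ) = ((2 * Real.pi * m * ξ : ℝ) : ℂ) * Complex.I := by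
      push_cast; ring
    rw [this, Complex.norm_exp_ofReal_mul_I, mul_one]
  have hp := (modulatedBump y).tsum_eq_tsum_fourier ξ
  have hl : ∑' n : ℤ, modulatedBump y (ξ + n) = Complex.exp (2 * Real.pi * y * ξ * Complex.I) := by
    rw [tsum_eq_single 0 fun n hn => ?_]
    · simp [coe_modulatedBump, modulate, cbump, bump_eq_one hξ]
    · have h1 : (1 : ℝ) ≤ |(n : ℝ)| := by exact_mod_cast Int.one_le_abs hn
      have h2 := abs_sub_abs_le_abs_sub (n : ℝ) (-ξ)
      rw [abs_neg, sub_neg_eq_add, add_comm (n : ℝ)] at h2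
      simp [coe_modulatedBump, modulate, cbump_eq_zero (show 3 / 4 ≤ |ξ + n| by linarith)]
  rw [hl] at hp
  rw [hp]
  convert hs.hasSum using 3 with m
  rw [SchwartzMap.fourier_coe, coe_modulatedBump, fourier_modulate, ← ofReal_kernel, ← kernel_neg,
    neg_sub, fourier_coe_apply]
  congr 2
  push_cast
  ring

/-- Translates of a function with spectrum in `[-1/4, 1/4]` are combinations of its integer
translates. -/
theorem hasSum_kernel_mul_fourier {a : ℝ → ℂ} (ha : Integrable a)
    (hsupp : ∀ ξ, 1 / 4 < |ξ| → a ξ = 0) (x y : ℝ) :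
    HasSum (fun m : ℤ => (kernel (y - m) : ℂ) * 𝓕 a (x - m)) (𝓕 a (x - y)) := by
  have hnorm : ∀ (z ξ : ℝ), ‖Complex.exp (↑(-2 * Real.pi * ξ * z) * Complex.I) • a ξ‖ = ‖a ξ‖ := by
    intro z ξ
    rw [norm_smul, Complex.norm_exp_ofReal_mul_I, one_mul]
  have hint : ∀ z : ℝ, Integrable
      fun ξ : ℝ => Complex.exp (↑(-2 * Real.pi * ξ * z) * Complex.I) • a ξ := by
    intro z
    refine ha.norm.mono' ?_ (Eventually.of_forall fun ξ => (hnorm z ξ).le)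
    have hc : Continuous fun ξ : ℝ => Complex.exp (↑(-2 * Real.pi * ξ * z) * Complex.I) := by
      fun_prop
    exact hc.aestronglyMeasurable.smul ha.aestronglyMeasurable
  have hpt : ∀ ξ : ℝ, HasSum (fun m : ℤ => (kernel (y - m) : ℂ) *
      (Complex.exp (↑(-2 * Real.pi * ξ * (x - m)) * Complex.I) • a ξ))
      (Complex.exp (↑(-2 * Real.pi * ξ * (x - y)) * Complex.I) • a ξ) := by
    intro ξ
    by_cases hξ : 1 / 4 < |ξ|
    · simp [hsupp ξ hξ]
    · have h := (hasSum_kernel_exp (not_lt.1 hξ) y).mul_right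
        (Complex.exp (↑(-2 * Real.pi * ξ * x) * Complex.I) * a ξ)
      rw [← mul_assoc, ← Complex.exp_add] at h
      convert! h using 2 with m
      · rw [smul_eq_mul, mul_assoc (kernel _ : ℂ), ← mul_assoc (Complex.exp _), ← Complex.exp_add]
        congr 3
        push_cast
        ring
      · congr 1
        push_cast
        ring
  -- Integrating the expansion of the exponential against `a`; absolute summability of the kernel
  -- allows the exchange.
  have h := hasSum_integral_of_summable_integral_norm (μ := volume)
    (F := fun (m : ℤ) (ξ : ℝ) => (kernel (y - m) : ℂ) *
      (Complex.exp (↑(-2 * Real.pi * ξ * (x - m)) * Complex.I) • a ξ))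
    (fun m => (hint (x - m)).const_mul _) ?_
  · simp only [integral_const_mul, (hpt _).tsum_eq] at h
    simpa only [Real.fourier_real_eq_integral_exp_smul] using h
  · simp only [norm_mul, hnorm, integral_const_mul, Complex.norm_real, Real.norm_eq_abs]
    exact (summable_kernel_shift y).mul_right _

/-! ### Invariance of the sums under the perturbation. -/

lemma exists_kernel_decay : ∃ A : ℤ → ℝ, (∀ j, 0 ≤ A j) ∧
    (∀ (j : ℤ) (s : ℝ), |s| ≤ 1 → |kernel (j + s)| ≤ A j) ∧ Summable fun j => mult j * A j := by
  obtain ⟨C, hC, h⟩ := (𝓕 (modulatedBump 0)).exists_norm_shift_le 0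
  refine ⟨fun j => C * ((mult j : ℝ) ^ 2)⁻¹, fun j => by positivity, fun j s hs => ?_, ?_⟩
  · rw [← kernel_neg, ← zero_sub]
    exact (Complex.abs_re_le_norm _).trans (h j s hs)
  · refine (summable_inv_mult.mul_left C).congr fun n => ?_
    have := (mult_pos n).ne'
    field_simp

lemma exists_abs_kernel_le : ∃ M : ℝ, ∀ v, |kernel v| ≤ M :=
  ⟨_, fun v => (Complex.abs_re_le_norm _).trans
    (SchwartzMap.norm_le_seminorm ℝ (𝓕 (modulatedBump 0)) v)⟩

/-- The sampling formula integrated over `y` from `n` to `n + t`, by dominated convergence. -/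
lemma hasSum_integral_kernel {h : 𝓢(ℝ, ℂ)}
    (hk : ∀ x y : ℝ, HasSum (fun m : ℤ => (kernel (y - m) : ℂ) * h (x - m)) (h (x - y)))
    (x : ℝ) (n : ℤ) (t : ℝ) :
    HasSum (fun k : ℤ => ((∫ s in (0 : ℝ)..t, kernel ((n - k : ℤ) + s) : ℝ) : ℂ) * h (x - k))
      (∫ s in (0 : ℝ)..t, h (x - (n + s))) := by
  obtain ⟨M, hM⟩ := exists_abs_kernel_le
  have hs : Summable fun k : ℤ => M * ‖h (x - k)‖ := by
    refine Summable.mul_left _ (Summable.of_nonneg_of_le (fun k => norm_nonneg _) (fun k => ?_)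
      (h.summable_norm_shift x))
    exact le_mul_of_one_le_left (norm_nonneg _) (one_le_mult k)
  have key := intervalIntegral.hasSum_integral_of_dominated_convergence (μ := volume)
    (a := 0) (b := t) (F := fun (k : ℤ) (s : ℝ) => (kernel ((n - k : ℤ) + s) : ℂ) * h (x - k))
    (f := fun s => h (x - (n + s))) (fun k _ => M * ‖h (x - k)‖) ?_ ?_ ?_ ?_ ?_
  · convert! key using 2 with k
    rw [intervalIntegral.integral_mul_const, intervalIntegral.integral_ofReal]
  · intro k
    have := continuous_kernel
    have hc : Continuous fun s : ℝ => (kernel ((n - k : ℤ) + s) : ℂ) * h (x - k) := by fun_prop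
    exact hc.aestronglyMeasurable
  · refine fun k => Eventually.of_forall fun s _ => ?_
    rw [norm_mul, Complex.norm_real]
    exact mul_le_mul_of_nonneg_right (hM _) (norm_nonneg _)
  · exact Eventually.of_forall fun s _ => hs
  · simp
  · refine Eventually.of_forall fun s _ => ?_
    convert! hk x (n + s) using 4 with k
    push_cast
    ring_nf

/-- Summing over the points costs `mult k`, which the decay of `h` absorbs. This justifies
exchanging the sums over `k` and over points. -/
lemma summable_prod_mul_shift {A : ℤ → ℝ} (hA0 : ∀ j, 0 ≤ A j)
    (hAs : Summable fun j => mult j * A j) {J : ℤ → PointIndex → ℝ}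
    (hJ : ∀ k p, |J k p| ≤ A (p.1 - k) * 1) (h : 𝓢(ℝ, ℂ)) (x : ℝ) :
    Summable fun q : ℤ × PointIndex => (J q.1 q.2 : ℂ) * h (x - q.1) := by
  have hk : ∀ k : ℤ, Summable (fun p : PointIndex => |J k p|) ∧
      ∑' p : PointIndex, |J k p| ≤ mult k * (2 * (∑' j, mult j * A j) * 1) := by
    intro k
    have h1 := norm_tsum_pointIndex_le (D := 1) zero_le_one hA0 hAs k
      (F := fun p => |J k p|) fun p => by rw [Real.norm_eq_abs, abs_abs]; exact hJ k p
    exact ⟨h1.1, (le_abs_self _).trans h1.2⟩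
  refine Summable.of_norm ?_
  simp only [norm_mul, Complex.norm_real, Real.norm_eq_abs]
  rw [summable_prod_of_nonneg (fun q => by positivity)]
  have hk' : ∀ k : ℤ, Summable fun p : PointIndex => |J k p| * ‖h (x - k)‖ := fun k =>
    Summable.mul_right (‖h (x - k)‖) (hk k).1
  refine ⟨hk', ?_⟩
  simp only [tsum_mul_right]
  refine Summable.of_nonneg_of_le (fun k => mul_nonneg (tsum_nonneg fun p => abs_nonneg _)
    (norm_nonneg _)) (fun k => ?_) ((h.summable_norm_shift x).mul_left (2 * (∑' j, mult j * A j)))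
  refine (mul_le_mul_of_nonneg_right (hk k).2 (norm_nonneg _)).trans (le_of_eq ?_)
  ring

lemma summable_prod_integral_kernel {t : PointIndex → ℝ} (ht : ∀ p, |t p| ≤ 1) (h : 𝓢(ℝ, ℂ))
    (x : ℝ) : Summable fun q : ℤ × PointIndex =>
      ((∫ s in (0 : ℝ)..t q.2, kernel ((q.2.1 - q.1 : ℤ) + s) : ℝ) : ℂ) * h (x - q.1) := by
  obtain ⟨A, hA0, hA, hAs⟩ := exists_kernel_decay
  refine summable_prod_mul_shift hA0 hAs
    (J := fun k p => ∫ s in (0 : ℝ)..t p, kernel ((p.1 - k : ℤ) + s)) (fun k p => ?_) h x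
  have h1 := intervalIntegral.norm_integral_le_of_norm_le_const (a := 0) (b := t p)
    (f := fun s => kernel ((p.1 - k : ℤ) + s)) (C := A (p.1 - k)) fun s hs => by
      refine hA _ s ?_
      have h2 := Set.uIoc_subset_uIcc hs
      rw [Set.mem_uIcc] at h2
      have h3 := abs_le.1 (ht p)
      rw [abs_le]
      constructor <;> rcases h2 with h | h <;> linarith
  rw [sub_zero] at h1
  exact h1.trans (mul_le_mul_of_nonneg_left (ht p) (hA0 _))

lemma SchwartzMap.hasSum_pointIndex_shift (φ : 𝓢(ℝ, ℂ)) (x : ℝ) :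
    HasSum (fun p : PointIndex => φ (x - p.1)) (∑' n : ℤ, mult n * φ (x - n)) := by
  have hs : Summable fun p : PointIndex => φ (x - p.1) :=
    summable_pointIndex (b := fun n => ‖φ (x - n)‖) (φ.summable_norm_shift x) fun p => le_rfl
  have h := hs.hasSum.sigma (g := fun n => mult n * φ (x - n)) fun n => by
    simpa using hasSum_fintype (fun _ : Fin (mult n) => φ (x - n))
  rw [h.tsum_eq]
  exact hs.hasSum

/-- If the perturbation `t` annihilates the interpolation kernel, then moving the points of the
integers with multiplicities by `t` does not change the sum of the translates of a function with
spectrum in `[-1/4, 1/4]`. -/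
theorem hasSum_fourier_perturbed {t : PointIndex → ℝ} (ht : ∀ p, |t p| ≤ 1)
    (ht0 : ∀ k : ℤ,
      HasSum (fun p : PointIndex => ∫ s in (0 : ℝ)..t p, kernel ((p.1 - k : ℤ) + s)) 0)
    (a : 𝓢(ℝ, ℂ)) (ha : ∀ ξ, 1 / 4 < |ξ| → a ξ = 0) (x : ℝ) :
    HasSum (fun p : PointIndex => 𝓕 a (x - (p.1 + t p))) (∑' n : ℤ, mult n * 𝓕 a (x - n)) := by
  have hcs : HasCompactSupport a := hasCompactSupport_of_forall_abs (R := 1) fun ξ hξ =>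
    ha ξ (by linarith)
  have hi1 : Integrable fun ξ : ℝ => ξ • a ξ :=
    (continuous_id.smul a.continuous).integrable_of_hasCompactSupport hcs.smul_left
  have hi2 : Integrable fun ξ : ℝ => (-2 * Real.pi * Complex.I * ξ) • a ξ := by
    have := hi1.const_mul (-2 * Real.pi * Complex.I)
    refine this.congr (Eventually.of_forall fun ξ => ?_)
    simp only [smul_eq_mul, Complex.real_smul]
    ring
  -- The derivative is the transform of a multiple of `ξ * a ξ`, so its spectrum is still in `[-1/4,
  -- 1/4]` and the sampling formula applies.
  set h : 𝓢(ℝ, ℂ) := SchwartzMap.derivCLM ℝ ℂ (𝓕 a) with hh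
  have hh' : ∀ v, h v = 𝓕 (fun ξ : ℝ => (-2 * Real.pi * Complex.I * ξ) • a ξ) v := fun v => by
    rw [hh, SchwartzMap.derivCLM_apply, SchwartzMap.fourier_coe,
      Real.deriv_fourier a.integrable hi1]
  have hk : ∀ x y : ℝ, HasSum (fun m : ℤ => (kernel (y - m) : ℂ) * h (x - m)) (h (x - y)) := by
    intro x y
    simp only [hh']
    exact hasSum_kernel_mul_fourier hi2 (fun ξ hξ => by simp [ha ξ hξ]) x y
  have hftc : ∀ p : PointIndex, 𝓕 a (x - (p.1 + t p)) =
      𝓕 a (x - p.1) - ∫ s in (0 : ℝ)..t p, h (x - (p.1 + s)) := by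
    intro p
    have h1 := intervalIntegral.integral_eq_sub_of_hasDerivAt (a := 0) (b := t p)
      (f := fun s : ℝ => 𝓕 a (x - (p.1 + s))) (f' := fun s => -h (x - (p.1 + s)))
      (fun s _ => by
        have h2 : HasDerivAt (⇑(𝓕 a : 𝓢(ℝ, ℂ))) (h (x - (p.1 + s))) (x - (p.1 + s)) := by
          rw [hh, SchwartzMap.derivCLM_apply]
          exact (𝓕 a).differentiableAt.hasDerivAt
        have h3 : HasDerivAt (fun s : ℝ => x - (p.1 + s)) (-1) s :=
          ((hasDerivAt_id s).const_add (p.1 : ℝ)).const_sub x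
        simpa [Function.comp_def] using h2.scomp s h3)
      (Continuous.intervalIntegrable (by have := h.continuous; fun_prop) _ _)
    rw [intervalIntegral.integral_neg, add_zero] at h1
    linear_combination -h1
  have hG := summable_prod_integral_kernel ht h x
  -- The double sum taken over points first is `0` by `ht0`; taken over `k` first, below, it is the
  -- total change in the translates.
  have hG0 : HasSum (fun q : ℤ × PointIndex =>
      ((∫ s in (0 : ℝ)..t q.2, kernel ((q.2.1 - q.1 : ℤ) + s) : ℝ) : ℂ) * h (x - q.1)) 0 := by
    have h1 := hG.hasSum.prod_fiberwise (g := fun _ => 0) fun k => by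
      simpa using ((Complex.hasSum_ofReal.2 (ht0 k)).mul_right (h (x - k)))
    rw [← h1.unique hasSum_zero]
    exact hG.hasSum
  have hG1 : HasSum (fun p : PointIndex => ∫ s in (0 : ℝ)..t p, h (x - (p.1 + s))) 0 :=
    ((Equiv.prodComm PointIndex ℤ).hasSum_iff.2 hG0).prod_fiberwise fun p =>
      hasSum_integral_kernel hk x p.1 (t p)
  simp only [hftc]
  have hd := ((𝓕 a).hasSum_pointIndex_shift x).sub hG1
  rwa [sub_zero] at hd

/-! ### Tiling with the integers counted with multiplicities. -/

/-- A smooth function supported in `[-1/4, 1/4]`, as a Schwartz function. -/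
noncomputable def toSchwartz (a : ℝ → ℂ) (ha : ContDiff ℝ ∞ a)
    (hsupp : ∀ ξ, 1 / 4 < |ξ| → a ξ = 0) : 𝓢(ℝ, ℂ) :=
  (hasCompactSupport_of_forall_abs (a := a) (R := 1) fun ξ h =>
    hsupp ξ (by linarith)).toSchwartzMap ha

/-- Poisson summation: `a` vanishes at every nonzero integer. -/
lemma tsum_fourier_shift {a : ℝ → ℂ} (ha : ContDiff ℝ ∞ a)
    (hsupp : ∀ ξ, 1 / 4 < |ξ| → a ξ = 0) (x : ℝ) : ∑' n : ℤ, 𝓕 a (x - n) = a 0 := by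
  have hp := (toSchwartz (modulate (-x) a) (contDiff_modulate (-x) ha)
    fun ξ hξ => by simp [modulate, hsupp ξ hξ]).tsum_eq_tsum_fourier 0
  have e : ⇑(toSchwartz (modulate (-x) a) (contDiff_modulate (-x) ha)
    fun ξ hξ => by simp [modulate, hsupp ξ hξ]) = modulate (-x) a := rfl
  rw [e, tsum_eq_single 0 fun n hn => ?_] at hp
  · simp only [SchwartzMap.fourier_coe, e, fourier_modulate] at hp
    rw [← (Equiv.neg ℤ).tsum_eq]
    simp only [modulate, zero_add, Int.cast_zero, Complex.ofReal_zero, mul_zero, zero_mul,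
      Complex.exp_zero, one_mul] at hp
    rw [hp]
    congr 1 with n
    simp [add_comm]
  · have h1 : (1 : ℝ) ≤ |(n : ℝ)| := by exact_mod_cast Int.one_le_abs hn
    simp [modulate, hsupp n (by linarith)]

/-- Summation by parts moves the second difference onto `n ^ 2 + 1`, where it equals `2`. -/
lemma tsum_mult_mul_second_difference {G : ℤ → ℂ} (hG : Summable fun n => mult n * ‖G n‖) :
    ∑' n, mult n * (G (n + 1) - 2 * G n + G (n - 1)) = 2 * ∑' n, G n := by
  have hs : ∀ k : ℤ, Summable fun n => (mult n : ℂ) * G (n - k) := fun k => by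
    refine Summable.of_norm ?_
    simpa using summable_mult_mul_shift (fun j => norm_nonneg (G j)) hG k
  have hshift : ∀ k : ℤ, HasSum (fun n => (mult (n + k) : ℂ) * G n)
      (∑' n, (mult n : ℂ) * G (n - k)) := fun k => by
    simpa [Function.comp_def] using (Equiv.addRight k).hasSum_iff.2 (hs k).hasSum
  have h0 := hs 0
  have h1 := hs 1
  have h2 := hs (-1)
  simp only [sub_zero, sub_neg_eq_add] at h0 h2
  have e1 : ∀ n, (mult n : ℂ) * (G (n + 1) - 2 * G n + G (n - 1)) =
      mult n * G (n + 1) - 2 * (mult n * G n) + mult n * G (n - 1) := fun n => by ring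
  have g1 := hshift 1
  have g2 := hshift (-1)
  have g0 := h0.hasSum
  simp only [sub_neg_eq_add] at g2
  have h3 := (g2.sub (g0.mul_left 2)).add g1
  have e2 : ∀ n, ((mult (n + -1) : ℂ) * G n - 2 * (mult n * G n)) + mult (n + 1) * G n = 2 * G n := by
    intro n
    have c : ∀ m : ℤ, (mult m : ℂ) = (m : ℂ) ^ 2 + 1 := fun m => by
      exact_mod_cast congrArg (fun r : ℝ => (r : ℂ)) (cast_mult m)
    simp only [c]
    push_cast
    ring
  simp only [e2] at h3
  simp only [e1]
  rw [← tsum_mul_left, h3.tsum_eq,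
    ((h2.hasSum.sub (h0.hasSum.mul_left 2)).add h1.hasSum).tsum_eq]

/-- For every level there is a nonzero Schwartz function with spectrum in `[-1/4, 1/4]` which tiles
at that level with the integers taken with multiplicities `n ^ 2 + 1`. -/
theorem exists_tiling_integers (w : ℂ) : ∃ a : 𝓢(ℝ, ℂ), (∀ ξ, 1 / 4 < |ξ| → a ξ = 0) ∧ 𝓕 a ≠ 0 ∧
    ∀ x, ∑' n : ℤ, mult n * 𝓕 a (x - n) = w := by
  -- The first term sets `ψ 0 = w / 2`, hence the level. The second vanishes at `0` and gives `ψ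
  -- (3/16) = 1`, keeping the function nonzero even when `w = 0`.
  set ψ : ℝ → ℂ := fun ξ => w / 2 * cbump (4 * ξ) + cbump (16 * ξ - 3) with hψ
  have hψc : ContDiff ℝ ∞ ψ :=
    (contDiff_const.mul (contDiff_cbump.comp (by fun_prop))).add (contDiff_cbump.comp (by fun_prop))
  have hψs : ∀ ξ, 1 / 4 < |ξ| → ψ ξ = 0 := fun ξ hξ => by
    rw [hψ]
    simp only
    rw [cbump_eq_zero, cbump_eq_zero, mul_zero, add_zero]
    · rcases lt_abs.1 hξ with h | h
      · exact le_abs.2 (Or.inl (by linarith))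
      · exact le_abs.2 (Or.inr (by linarith))
    · rw [abs_mul, abs_of_pos (by norm_num : (0 : ℝ) < 4)]; linarith
  have hψ0 : ψ 0 = w / 2 := by
    simp only [hψ, mul_zero, zero_sub]
    rw [cbump_eq_zero (ξ := -3) (by norm_num), cbump, bump_eq_one (by norm_num)]
    simp
  have hψ1 : ψ (3 / 16) = 1 := by
    simp only [hψ]
    rw [cbump_eq_zero (by norm_num), cbump, bump_eq_one (by norm_num)]
    simp
  let m : ℝ → 𝓢(ℝ, ℂ) := fun y => toSchwartz (modulate y ψ) (contDiff_modulate y hψc)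
    fun ξ hξ => by simp [modulate, hψs ξ hξ]
  have hm : ∀ y, ⇑(m y) = modulate y ψ := fun _ => rfl
  have hFm : ∀ y v, 𝓕 (m y) v = 𝓕 ψ (v - y) := fun y v => by
    rw [SchwartzMap.fourier_coe, hm, fourier_modulate]
  let a : 𝓢(ℝ, ℂ) := m (-1) - (2 : ℂ) • m 0 + m 1
  have haξ : ∀ ξ, a ξ = modulate (-1) ψ ξ - 2 * modulate 0 ψ ξ + modulate 1 ψ ξ := fun ξ => by
    simp [a, hm]
  have hFa : ∀ v, 𝓕 a v = 𝓕 ψ (v + 1) - 2 * 𝓕 ψ v + 𝓕 ψ (v - 1) := fun v => by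
    have : 𝓕 a = 𝓕 (m (-1)) - (2 : ℂ) • 𝓕 (m 0) + 𝓕 (m 1) := by
      simp only [a, sub_eq_add_neg, ← neg_smul, FourierTransform.fourier_add,
        FourierTransform.fourier_smul]
    rw [this]
    simp [hFm]
  refine ⟨a, fun ξ hξ => by simp [haξ, modulate, hψs ξ hξ], fun h0 => ?_, fun x => ?_⟩
  · have h1 : a = 0 := by
      rw [← FourierTransform.fourierInv_fourier_eq (F := 𝓢(ℝ, ℂ)) a, h0,
        FourierTransform.fourierInv_zero]
    have h2 := haξ (3 / 16)
    rw [h1] at h2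
    have h3 := congrArg Complex.re h2
    have e1 : (2 * Real.pi * (-1 : ℝ) * (3 / 16 : ℝ) * Complex.I : ℂ) =
        ((-(3 * Real.pi / 8) : ℝ) : ℂ) * Complex.I := by push_cast; ring
    have e2 : (2 * Real.pi * (1 : ℝ) * (3 / 16 : ℝ) * Complex.I : ℂ) =
        ((3 * Real.pi / 8 : ℝ) : ℂ) * Complex.I := by push_cast; ring
    rw [modulate_zero] at h3
    simp only [modulate, hψ1, e1, e2, mul_one, Complex.add_re, Complex.sub_re,
      Complex.exp_ofReal_mul_I_re, Real.cos_neg, zero_apply, Complex.zero_re,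
      Complex.re_ofNat] at h3
    -- Here `a (3/16) = 2 * cos (3π/8) - 2`, which is not zero.
    have hpi := Real.pi_pos
    have h4 := (Real.cos_eq_one_iff_of_lt_of_lt (x := 3 * Real.pi / 8) (by linarith)
      (by linarith)).1 (by linarith)
    linarith
  · have hG : Summable fun n : ℤ => mult n * ‖𝓕 ψ (x - n)‖ := by
      exact ((𝓕 (m 0)).summable_norm_shift x).congr fun n => by rw [hFm, sub_zero]
    have h1 := tsum_mult_mul_second_difference hG
    rw [tsum_fourier_shift hψc hψs, hψ0] at h1
    rw [show w = 2 * (w / 2) by ring, ← h1]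
    congr 1 with n
    rw [hFa]
    push_cast
    ring_nf

/-! ### Density, growth and discreteness of the perturbed points. -/

/-- The point with index `p` of the multiset of integers perturbed by `t`. -/
def perturbedPoint (t : PointIndex → ℝ) (p : PointIndex) : ℝ := p.1 + t p

section Geometry

variable {t : PointIndex → ℝ}

lemma perturbedPoint_injective (ht : ∀ p, |t p| < 1 / 4)
    (hinj : ∀ n, Function.Injective fun i => t ⟨n, i⟩) :
    Function.Injective (perturbedPoint t) := by
  rintro ⟨n, i⟩ ⟨m, j⟩ h
  simp only [perturbedPoint] at h
  have h1 := abs_lt.1 (ht ⟨n, i⟩)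
  have h2 := abs_lt.1 (ht ⟨m, j⟩)
  have h3 : (n : ℝ) < m + 1 := by linarith
  have h4 : (m : ℝ) < n + 1 := by linarith
  have h5 : n < m + 1 := by exact_mod_cast h3
  have h6 : m < n + 1 := by exact_mod_cast h4
  obtain rfl : n = m := by omega
  rw [hinj n (add_left_cancel h)]

lemma not_hasBoundedDensity_range (ht : ∀ p, |t p| < 1 / 4)
    (hinj : ∀ n, Function.Injective fun i => t ⟨n, i⟩) :
    ¬ HasBoundedDensity (Set.range (perturbedPoint t)) := by
  intro h
  -- The supposed supremum `N` is itself used as the integer: the unit window centred there holds at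
  -- least `N ^ 2 + 1 > N` points.
  obtain ⟨N, hN⟩ := ENat.ne_top_iff_exists.1 h.ne
  have h1 : (Set.range fun i : Fin (mult N) => perturbedPoint t ⟨N, i⟩) ⊆
      Set.range (perturbedPoint t) ∩ Set.Ico ((N : ℝ) - 1 / 2) ((N : ℝ) - 1 / 2 + 1) := by
    rintro _ ⟨i, rfl⟩
    have h2 := abs_lt.1 (ht ⟨N, i⟩)
    refine ⟨⟨_, rfl⟩, ?_, ?_⟩ <;> simp only [perturbedPoint, Int.cast_natCast] <;> linarith
  have h3 : Function.Injective fun i : Fin (mult N) => perturbedPoint t ⟨N, i⟩ :=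
    (perturbedPoint_injective ht hinj).comp sigma_mk_injective
  have h4 := (h3.encard_range.trans (Set.encard_le_encard h1)).trans (le_iSup (fun x : ℝ =>
    (Set.range (perturbedPoint t) ∩ Set.Ico x (x + 1)).encard) ((N : ℝ) - 1 / 2))
  rw [← hN] at h4
  simp only [ENat.card_eq_coe_fintype_card, Fintype.card_fin, Nat.cast_le, mult,
    Int.natAbs_natCast] at h4
  nlinarith

lemma range_inter_Ioo_subset (ht : ∀ p, |t p| < 1 / 4) (r : ℝ) :
    Set.range (perturbedPoint t) ∩ Set.Ioo (-r) r ⊆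
      ((((Finset.Icc (-(⌈r⌉₊ + 1 : ℤ)) (⌈r⌉₊ + 1)).sigma fun n =>
        (Finset.univ : Finset (Fin (mult n)))).image (perturbedPoint t) : Finset ℝ) : Set ℝ) := by
  rintro _ ⟨⟨⟨n, i⟩, rfl⟩, h1, h2⟩
  have h3 := abs_lt.1 (ht ⟨n, i⟩)
  have h4 := Nat.le_ceil r
  simp only [perturbedPoint] at h1 h2
  refine Finset.mem_coe.2 (Finset.mem_image_of_mem _ ?_)
  simp only [Finset.mem_sigma, Finset.mem_Icc, Finset.mem_univ, and_true]
  constructor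
  · have : (-(⌈r⌉₊ + 1 : ℤ) : ℝ) ≤ n := by push_cast; linarith
    exact_mod_cast this
  · have : (n : ℝ) ≤ ((⌈r⌉₊ + 1 : ℤ) : ℝ) := by push_cast; linarith
    exact_mod_cast this

lemma hasTemperedGrowth_range (ht : ∀ p, |t p| < 1 / 4) :
    HasTemperedGrowth (Set.range (perturbedPoint t)) := by
  refine ⟨fun r => (Finset.finite_toSet _).subset (range_inter_Ioo_subset ht r), 3, ?_⟩
  -- With `M ≤ 3r` and `r ≥ 1`, the count `(2M + 1)(M ^ 2 + 1)` is at most `7r * 10r ^ 2`.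
  refine Asymptotics.IsBigO.of_bound 70 ?_
  filter_upwards [eventually_ge_atTop 1] with r hr
  rw [Real.norm_of_nonneg (by positivity), Real.norm_of_nonneg (by positivity)]
  have h1 := (Set.ncard_le_ncard (range_inter_Ioo_subset ht r) (Finset.finite_toSet _))
  rw [Set.ncard_coe_finset] at h1
  replace h1 := h1.trans Finset.card_image_le
  set M : ℕ := ⌈r⌉₊ + 1 with hM
  rw [Finset.card_sigma] at h1
  have h2 : ∑ n ∈ Finset.Icc (-(⌈r⌉₊ + 1 : ℤ)) (⌈r⌉₊ + 1),
      (Finset.univ : Finset (Fin (mult n))).card ≤ (2 * M + 1) * (M ^ 2 + 1) := by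
    refine (Finset.sum_le_card_nsmul _ _ (M ^ 2 + 1) fun n hn => ?_).trans (le_of_eq ?_)
    · rw [Finset.card_fin, mult]
      have : n.natAbs ≤ M := by rw [Finset.mem_Icc] at hn; omega
      gcongr
    · rw [Int.card_Icc, smul_eq_mul]
      congr 1
      omega
  have hMr : (M : ℝ) ≤ 3 * r := by
    rw [hM]; push_cast
    linarith [Nat.ceil_lt_add_one (by linarith : 0 ≤ r)]
  have h3 : ((Set.range (perturbedPoint t) ∩ Set.Ioo (-r) r).ncard : ℝ) ≤
      (2 * M + 1) * ((M : ℝ) ^ 2 + 1) := by exact_mod_cast h1.trans h2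
  calc _ ≤ _ := h3
    _ ≤ (7 * r) * (10 * r ^ 2) := by
      have hM0 : (0 : ℝ) ≤ M := Nat.cast_nonneg M
      have : (M : ℝ) ^ 2 ≤ (3 * r) ^ 2 := by gcongr
      refine mul_le_mul (by linarith) (by nlinarith) (by positivity) (by positivity)
    _ = 70 * r ^ 3 := by ring

lemma isDiscrete_of_finite_inter_Ioo {Λ : Set ℝ} (h : ∀ r : ℝ, (Λ ∩ Set.Ioo (-r) r).Finite) :
    IsDiscrete Λ := by
  rw [isDiscrete_iff_discreteTopology, discreteTopology_subtype_iff']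
  intro x hx
  refine ⟨Set.Ioo (-(|x| + 1)) (|x| + 1) \ ((Λ ∩ Set.Ioo (-(|x| + 1)) (|x| + 1)) \ {x}),
    isOpen_Ioo.sdiff ((h (|x| + 1)).subset Set.sdiff_subset).isClosed, ?_⟩
  have hx' : x ∈ Set.Ioo (-(|x| + 1)) (|x| + 1) :=
    ⟨by linarith [neg_abs_le x], by linarith [le_abs_self x]⟩
  ext y
  simp only [Set.mem_inter_iff, Set.mem_sdiff, Set.mem_singleton_iff]
  constructor
  · rintro ⟨⟨h1, h2⟩, h3⟩
    by_contra hy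
    exact h2 ⟨⟨h3, h1⟩, hy⟩
  · rintro rfl
    exact ⟨⟨hx', fun h => h.2 rfl⟩, hx⟩

end Geometry

/-! ### The main theorem. -/

theorem theorem1p8 (ε : ℝ) (hε : 0 < ε) :
    ∃ Λ : Set ℝ, ¬ HasBoundedDensity Λ ∧ HasTemperedGrowth Λ ∧
      Λ ⊆ Metric.thickening ε (Set.range ((↑) : ℤ → ℝ)) ∧
      ∀ w : ℂ, ∃ f : 𝓢(ℝ, ℂ), f ≠ 0 ∧ IsTiling f Λ w := by
  obtain ⟨B, hB0, hB, hBs⟩ := exists_kernel_bound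
  obtain ⟨t, hinj, hlt, hsum⟩ := exists_perturbation continuous_kernel kernel_int hB0 hB hBs
    (ε := min ε (1 / 4)) (by positivity)
  have ht : ∀ p, |t p| < 1 / 4 := fun p => (hlt p).trans_le (min_le_right _ _)
  have hgrowth := hasTemperedGrowth_range ht
  refine ⟨Set.range (perturbedPoint t), not_hasBoundedDensity_range ht hinj, hgrowth, ?_, ?_⟩
  · rintro _ ⟨p, rfl⟩
    rw [Metric.mem_thickening_iff]
    refine ⟨p.1, ⟨p.1, rfl⟩, ?_⟩
    rw [perturbedPoint, Real.dist_eq, add_sub_cancel_left]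
    exact (hlt p).trans_le (min_le_left _ _)
  · intro w
    obtain ⟨a, ha, ha0, haw⟩ := exists_tiling_integers w
    refine ⟨𝓕 a, ha0, (𝓕 a).integrable, isDiscrete_of_finite_inter_Ioo hgrowth.1,
      Eventually.of_forall fun x => ?_⟩
    have h1 := hasSum_fourier_perturbed (fun p => (ht p).le.trans (by norm_num)) hsum a ha x
    rw [haw] at h1
    have h2 : HasSum (fun b : Set.range (perturbedPoint t) => 𝓕 a (x - b)) w :=
      (Equiv.ofInjective _ (perturbedPoint_injective ht hinj)).hasSum_iff.1 h1
    exact ⟨h2.summable.norm, h2⟩
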